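/- Let $k\ge 2$ be an integer, let $H$ be a finite simple graph with at least one edge, and let $\delta>0$ be a real number. Then there is an integer $n_0$ (depending on $k$, $H$ and $\delta$) such that for all integers $n\ge n_0$, $$t\bigl(n,\,GR_{k-1}(\mathscr H)-1\bigr)\;\le\; f_k(n,H)\;<\; t\bigl(n,\,GR^{*}_k(H)-1\bigr)+\delta n^2 .$$ Here: - $t(n,r)$ is the number of edges of the Turán graph $T_r(n)$, the complete $r$-partite graph on $n$ vertices with class sizes as equal as possible. - $f_k(n,H)$ is the maximum, over all (not necessarily proper) edge-colorings of $K_n$ with colors from $\{1,\dots,k\}$, of the number of edges contained in no rainbow triangle (three edges of pairwise distinct colors) and in no monochromatic copy of $H$. - $\mathscr H$ is the set of all homomorphic copies of $H$, i.e. of all finite simple graphs $G$ for which there is a map $\varphi:V(H)\to V(G)$ with $\varphi(u)\varphi(v)\in E(G)$ for every $uv\in E(H)$. - $GR_{k-1}(\mathscr H)$ is the minimum integer $n$ such that every edge-coloring of $K_n$ with colors from $\{1,\dots,k-1\}$ and without rainbow triangles contains a monochromatic copy of some $G\in\mathscr H$. - $GR^{*}_k(H)$ is the minimum integer $n$ such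 that for every coloring $c$ of the vertices and edges of $K_n$ with colors from $\{1,\dots,k\}$, at least one of the following holds: the edge-coloring contains a rainbow triangle or a monochromatic copy of some $G\in\mathscr H$; or some edge has the same color as one of its two endpoints. -/

import Mathlib

namespace GallaiEdges

open SimpleGraph

/-- The Turán number `t(n, r)`: the number of edges of the Turán graph `T_r(n)`, the complete
`r`-partite graph on `n` vertices with class sizes as equal as possible (`r ≥ 1`). -/
def turanEdges (n r : ℕ) : ℕ := (turanGraph n r).edgeFinset.card

/-- `x, y, z` span a rainbow triangle in the edge-coloured complete graph. -/
def IsRainbowTriangle {V K : Type*} (C : TopEdgeLabeling V K) (x y z : V) : Prop :=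
  ∃ (hxy : x ≠ y) (hyz : y ≠ z) (hxz : x ≠ z),
    C.get x y hxy ≠ C.get y z hyz ∧ C.get x y hxy ≠ C.get x z hxz ∧
      C.get y z hyz ≠ C.get x z hxz

/-- A Gallai colouring: an edge-colouring of a complete graph without rainbow triangles. -/
def IsGallai {V K : Type*} (C : TopEdgeLabeling V K) : Prop :=
  ∀ x y z : V, ¬ IsRainbowTriangle C x y z

/-- The coloured complete graph contains a monochromatic copy of `G`: for some colour `i`, the
graph formed by the edges of colour `i` contains `G` as a (not necessarily induced) subgraph. -/
def HasMonoCopy {V K W : Type*} (G : SimpleGraph W) (C : TopEdgeLabeling V K) : Prop :=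
  ∃ i : K, G.IsContained (C.labelGraph i)

/-- The set of all (finite) homomorphic copies of `H`, that is, of all finite graphs `G` that
admit a graph homomorphism from `H`. Every finite graph is represented with vertex set `Fin m`. -/
def homCopies {V : Type*} (H : SimpleGraph V) : Set (Σ m : ℕ, SimpleGraph (Fin m)) :=
  {G | Nonempty (H →g G.2)}

/-- The Gallai-Ramsey number `GR_k(𝓕)` of a set `𝓕` of graphs: the minimum `n` such that every
Gallai-`k`-colouring of `K_n` contains a monochromatic copy of some member of `𝓕`. -/
noncomputable def gallaiRamsey (k : ℕ) (𝓕 : Set (Σ m : ℕ, SimpleGraph (Fin m))) : ℕ :=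
  sInf {n : ℕ | ∀ C : TopEdgeLabeling (Fin n) (Fin k), IsGallai C → ∃ G ∈ 𝓕, HasMonoCopy G.2 C}

/-- `GR*_k(H)`: the minimum `n` such that for every colouring of the vertices and edges of `K_n`
(equivalently, of the nonempty subsets of size at most two of an `n`-set) with `k` colours, the
edge-colouring contains a rainbow triangle or a monochromatic homomorphic copy of `H`, or some edge
has the same colour as one of its two ends. -/
noncomputable def gallaiRamseyStar {V : Type*} (k : ℕ) (H : SimpleGraph V) : ℕ :=
  sInf {n : ℕ | ∀ (v : Fin n → Fin k) (C : TopEdgeLabeling (Fin n) (Fin k)),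
    (∃ x y z, IsRainbowTriangle C x y z) ∨
    (∃ G ∈ homCopies H, HasMonoCopy G.2 C) ∨
    (∃ (i j : Fin n) (hij : i ≠ j), C.get i j hij = v i ∨ C.get i j hij = v j)}

/-- The set of edges of the coloured complete graph that are contained in neither a rainbow triangle
nor a monochromatic copy of `H`. -/
def goodEdges {V K W : Type*} (H : SimpleGraph W) (C : TopEdgeLabeling V K) : Set (Sym2 V) :=
  {e | e ∈ (⊤ : SimpleGraph V).edgeSet ∧
    (¬ ∃ x y z, IsRainbowTriangle C x y z ∧ (e = s(x, y) ∨ e = s(y, z) ∨ e = s(x, z))) ∧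
    (¬ ∃ (i : K) (φ : H.Copy (C.labelGraph i)), e ∈ φ.toSubgraph.edgeSet)}

/-- `f_k(n, H)`: the maximum, over all `k`-edge-colourings of `K_n`, of the number of edges contained
in neither a rainbow triangle nor a monochromatic copy of `H`. -/
noncomputable def maxGoodEdges {W : Type*} (k n : ℕ) (H : SimpleGraph W) : ℕ :=
  ⨆ C : TopEdgeLabeling (Fin n) (Fin k), (goodEdges H C).ncard

end GallaiEdges

namespace GallaiEdges

open SimpleGraph

/-! Upper bound: put `r = GR*_k(H) - 1`. With `t(n, r) + δn²` good edges, Erdős–Stone gives a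
complete `(r+1)`-partite graph of good edges with large parts. Ramsey's theorem shrinks the parts
until each part and each pair of parts is monochromatic (`exists_isBlowup`). This colours the
vertices and edges of `K_{r+1}`, and each of the three outcomes in the definition of `GR*` puts a
good edge in a rainbow triangle or a monochromatic `H` (`not_isBlowup_of_goodEdges`).

Lower bound: blow up an extremal Gallai `(k-1)`-colouring to the Turán graph and give all edges
inside classes the unused colour; every Turán edge is then good. -/

/-! ### Ramsey's theorem -/

theorem exists_endHomogeneous (K : Type*) [Finite K] (m : ℕ) :
    ∃ T : ℕ, ∀ (f : ℕ → ℕ → K) (S : Finset ℕ), T ≤ S.card →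
      ∃ S' ⊆ S, S'.card = m ∧ ∃ g : ℕ → K, ∀ a ∈ S', ∀ b ∈ S', a < b → f a b = g a := by
  classical
  have := Fintype.ofFinite K
  induction m with
  | zero => exact ⟨0, fun f S _ => ⟨∅, by simp, by simp, fun a => f a a, by simp⟩⟩
  | succ m ih =>
    obtain ⟨T, hT⟩ := ih
    -- The extra element is the minimum `a`; by pigeonhole, `f a` is constant on `T` of the others.
    refine ⟨Fintype.card K * T + 1, fun f S hS => ?_⟩
    have hne : S.Nonempty := Finset.card_pos.1 (by omega)
    set a := S.min' hne with ha
    have haS : a ∈ S := S.min'_mem hne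
    have hcard : (Finset.univ : Finset K).card * T ≤ (S.erase a).card := by
      rw [Finset.card_erase_of_mem haS, Finset.card_univ]; omega
    obtain ⟨c, -, hc⟩ := Finset.exists_le_card_fiber_of_mul_le_card_of_maps_to
      (f := f a) (fun _ _ => Finset.mem_univ _) ⟨f a a, Finset.mem_univ _⟩ hcard
    obtain ⟨S', hS', hcard', g, hg⟩ := hT f _ hc
    have hmem : ∀ b ∈ S', (b ≠ a ∧ b ∈ S) ∧ f a b = c := fun b hb => by
      simpa using hS' hb
    have haS' : a ∉ S' := fun h => (hmem a h).1.1 rfl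
    refine ⟨insert a S', ?_, by rw [Finset.card_insert_of_notMem haS', hcard'],
      Function.update g a c, ?_⟩
    · intro b hb
      rcases Finset.mem_insert.1 hb with rfl | hb
      · exact haS
      · exact (hmem b hb).1.2
    · intro x hx y hy hxy
      rcases Finset.mem_insert.1 hx with rfl | hx
      · rcases Finset.mem_insert.1 hy with rfl | hy
        · exact absurd hxy (lt_irrefl _)
        · simpa using (hmem y hy).2
      · rcases Finset.mem_insert.1 hy with rfl | hy
        · exact absurd (S.min'_le x (hmem x hx).1.2) (not_le.2 hxy)
        · rw [Function.update_of_ne (hmem x hx).1.1]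
          exact hg x hx y hy hxy

/-- **Ramsey's theorem** for pairs and finitely many colours. -/
theorem exists_ramsey (K : Type*) [Finite K] (m : ℕ) :
    ∃ T : ℕ, ∀ f : Fin T → Fin T → K, ∃ (e : Fin m ↪o Fin T),
      ∀ a b a' b', a < b → a' < b' → f (e a) (e b) = f (e a') (e b') := by
  classical
  have := Fintype.ofFinite K
  obtain ⟨T, hT⟩ := exists_endHomogeneous K (Fintype.card K * m)
  refine ⟨T + 1, fun f => ?_⟩
  obtain ⟨S, hS, hcard, g, hg⟩ := hT (fun a b => f (Fin.ofNat _ a) (Fin.ofNat _ b))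
    (Finset.range (T + 1)) (by simp)
  obtain ⟨c, -, hc⟩ := Finset.exists_le_card_fiber_of_mul_le_card_of_maps_to
      (s := S) (t := Finset.univ) (n := m)
      (f := g) (fun _ _ => Finset.mem_univ _) ⟨f 0 0, Finset.mem_univ _⟩
      (by rw [Finset.card_univ, hcard])
  obtain ⟨S', hS', hm⟩ := Finset.exists_subset_card_eq hc
  have hmem : ∀ b ∈ S', b ∈ S ∧ g b = c := fun b hb => by simpa using hS' hb
  have hlt : ∀ b ∈ S', b < T + 1 := fun b hb => Finset.mem_range.1 (hS (hmem b hb).1)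
  let e₀ := S'.orderEmbOfFin hm
  have he₀ : ∀ i, e₀ i ∈ S' := fun i => S'.orderEmbOfFin_mem hm i
  let e : Fin m ↪o Fin (T + 1) := OrderEmbedding.ofStrictMono
    (fun i => ⟨e₀ i, hlt _ (he₀ i)⟩) (fun i j hij =>
      Fin.mk_lt_mk.2 (e₀.strictMono hij))
  have key : ∀ a b, a < b → f (e a) (e b) = c := fun a b hab => by
    have h := hg _ (hmem _ (he₀ a)).1 _ (hmem _ (he₀ b)).1 (e₀.strictMono hab)
    have hof : ∀ i, Fin.ofNat (T + 1) (e₀ i) = e i := fun i => by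
      exact Fin.ext (Nat.mod_eq_of_lt (hlt _ (he₀ i)))
    rw [hof, hof, (hmem _ (he₀ a)).2] at h
    exact h
  exact ⟨e, fun a b a' b' h h' => (key a b h).trans (key a' b' h').symm⟩

/-! ### Turán numbers and Erdős–Stone -/

/-- An upper bound for the Turán number of a complete equipartite graph in `r + 1` parts. -/
theorem extremalNumber_completeEquipartiteGraph_le {ε : ℝ} (hε : 0 < ε) {r t : ℕ}
    (hr : 1 ≤ r) (ht : t ≠ 0) :
    ∃ N : ℕ, ∀ n : ℕ, N ≤ n →
      (extremalNumber n (completeEquipartiteGraph (r + 1) t) : ℝ) ≤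
        N ^ 2 + (1 - 1 / r + ε) * (n * (n + 1) / 2) := by
  classical
  obtain ⟨N, hN⟩ := Filter.eventually_atTop.1
    (eventually_completeEquipartiteGraph_isContained_of_minDegree hε r t)
  set F := completeEquipartiteGraph (r + 1) t with hF
  have hr' : (0 : ℝ) ≤ 1 - 1 / r := by
    have : (1 : ℝ) ≤ r := by exact_mod_cast hr
    rw [sub_nonneg]; exact (div_le_one (by linarith)).2 this
  have hbot : F ≠ ⊥ := by
    rw [hF, Ne, completeEquipartiteGraph_eq_bot_iff]; omega
  refine ⟨N, fun n hn => ?_⟩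
  -- Deleting a minimum-degree vertex from an extremal graph on `n + 1` vertices loses less than `(1
  -- - 1/r + ε)(n + 1)` edges, by the minimum-degree Erdős–Stone theorem; `N ^ 2` pays for the base
  -- case.
  induction n, hn using Nat.le_induction with
  | base =>
    have h1 : extremalNumber N F ≤ N ^ 2 := by
      have := (extremalNumber_le_iff (V := Fin N) F (N ^ 2)).2 (fun G _ _ => by
        refine (card_edgeFinset_le_card_choose_two (G := G)).trans ?_
        rw [Fintype.card_fin, Nat.choose_two_right, sq]
        exact (Nat.div_le_self _ _).trans (Nat.mul_le_mul_left _ (Nat.sub_le _ _)))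
      simpa using this
    have h2 : (extremalNumber N F : ℝ) ≤ (N : ℝ) ^ 2 := by exact_mod_cast h1
    have h3 : 0 ≤ (1 - 1 / (r : ℝ) + ε) * (N * (N + 1) / 2) := by positivity
    linarith
  | succ n hn ih =>
    obtain ⟨G, _, hG⟩ := exists_isExtremal_free (V := Fin (n + 1)) hbot
    have hfree : F.Free G := hG.prop
    have hcard := card_edgeFinset_of_isExtremal_free hG
    rw [Fintype.card_fin] at hcard
    obtain ⟨v, hv⟩ := G.exists_minimal_degree_vertex
    have hdel := card_edgeFinset_deleteIncidenceSet_le_extremalNumber hfree v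
    rw [card_edgeFinset_deleteIncidenceSet, Fintype.card_fin, hcard, ← hv,
      Nat.add_sub_cancel] at hdel
    have hdeg : (G.minDegree : ℝ) < (1 - 1 / r + ε) * ((n + 1 : ℕ) : ℝ) := by
      by_contra h
      exact hfree (hN (n + 1) (by omega) (not_lt.1 h))
    have h4 : (extremalNumber (n + 1) F : ℝ) ≤ extremalNumber n F + G.minDegree := by
      exact_mod_cast Nat.sub_le_iff_le_add.1 hdel
    push_cast at hdeg ⊢
    nlinarith

/-- From the exact formula: `r ^ 2` absorbs the remainder `n % r`, and `1` the rounding of the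
division. -/
theorem turanEdges_ge (n : ℕ) {r : ℕ} (hr : 1 ≤ r) :
    (1 - 1 / r : ℝ) * (n ^ 2 / 2) - (r ^ 2 + 1) ≤ turanEdges n r := by
  have hr0 : (0 : ℝ) < r := by exact_mod_cast hr
  have hmod : n % r < r := Nat.mod_lt _ hr
  have h1 : (n ^ 2 - (n % r) ^ 2) * (r - 1) / (2 * r) ≤ turanEdges n r := by
    unfold turanEdges
    convert Nat.le.intro (card_edgeFinset_turanGraph (n := n) (r := r)).symm
  set a := (n ^ 2 - (n % r) ^ 2) * (r - 1) with ha
  have h2 : (a : ℝ) < (turanEdges n r + 1) * (2 * r) := by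
    have : a < (turanEdges n r + 1) * (2 * r) := by
      rw [← Nat.div_lt_iff_lt_mul (by omega)]; omega
    exact_mod_cast this
  have h3 : (a : ℝ) = ((n : ℝ) ^ 2 - ((n % r : ℕ) : ℝ) ^ 2) * (r - 1) := by
    rw [ha, Nat.cast_mul, Nat.cast_sub (Nat.pow_le_pow_left (Nat.mod_le _ _) 2),
      Nat.cast_sub hr]
    push_cast; ring
  have h4 : (((n % r : ℕ) : ℝ)) ^ 2 ≤ (r : ℝ) ^ 2 := by
    exact_mod_cast Nat.pow_le_pow_left hmod.le 2
  have h5 : (1 : ℝ) ≤ r := by exact_mod_cast hr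
  have h6 : ((n : ℝ) ^ 2 - (r : ℝ) ^ 2) * (r - 1) < (turanEdges n r + 1) * (2 * r) := by
    refine lt_of_le_of_lt ?_ (h3 ▸ h2)
    exact mul_le_mul_of_nonneg_right (by linarith) (by linarith)
  have h7 : (1 - 1 / r : ℝ) * (n ^ 2 / 2) = ((n : ℝ) ^ 2 * (r - 1)) / (2 * r) := by
    field_simp
  have h8 : ((n : ℝ) ^ 2 * (r - 1)) / (2 * r) ≤ turanEdges n r + 1 + r ^ 2 := by
    rw [div_le_iff₀ (by positivity)]
    nlinarith [mul_nonneg (sq_nonneg (r : ℝ)) hr0.le, sq_nonneg (r : ℝ)]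
  linarith

/-- The edge version of the **Erdős–Stone theorem**. -/
theorem exists_completeEquipartiteGraph_isContained {δ : ℝ} (hδ : 0 < δ) {r t : ℕ}
    (hr : 1 ≤ r) (ht : t ≠ 0) :
    ∃ N : ℕ, ∀ n : ℕ, N ≤ n → ∀ G : SimpleGraph (Fin n),
      (turanEdges n r : ℝ) + δ * n ^ 2 ≤ G.edgeSet.ncard →
      (completeEquipartiteGraph (r + 1) t).IsContained G := by
  classical
  obtain ⟨N, hN⟩ := extremalNumber_completeEquipartiteGraph_le hδ hr ht
  have hr5 : (1 : ℝ) ≤ r := by exact_mod_cast hr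
  -- The two bounds leave a gap of `δn²/2`, which must beat the constant and linear error terms.
  obtain ⟨M, hM⟩ := exists_nat_gt ((2 / δ) * (N ^ 2 + r ^ 2 + 1 + (1 + δ) / 2))
  refine ⟨max N (M + 1), fun n hn G hG => ?_⟩
  have hnN : N ≤ n := (le_max_left _ _).trans hn
  have hnM : M + 1 ≤ n := (le_max_right _ _).trans hn
  apply IsContained.of_extremalNumber_lt_card_edgeFinset
  rw [Fintype.card_fin, ← Set.ncard_coe_finset, coe_edgeFinset]
  have h1 := hN n hnN
  have h2 := turanEdges_ge n hr
  have hn1 : (1 : ℝ) ≤ n := by exact_mod_cast (by omega : 1 ≤ n)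
  have hMn : (M : ℝ) ≤ n := by exact_mod_cast (by omega : M ≤ n)
  have h3 : N ^ 2 + r ^ 2 + 1 + (1 + δ) / 2 < δ / 2 * n := by
    have h := hM.trans_le hMn
    have h' := mul_lt_mul_of_pos_left h (half_pos hδ)
    have e : δ / 2 * (2 / δ * ((N : ℝ) ^ 2 + r ^ 2 + 1 + (1 + δ) / 2)) =
      N ^ 2 + r ^ 2 + 1 + (1 + δ) / 2 := by field_simp
    linarith
  have hi : 0 < 1 / (r : ℝ) := by positivity
  have h4 : ((N : ℝ) ^ 2 + r ^ 2 + 1) + (1 + δ) / 2 * n ≤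
      (N ^ 2 + r ^ 2 + 1 + (1 + δ) / 2) * n := by nlinarith [sq_nonneg (N : ℝ), sq_nonneg (r : ℝ)]
  have h5 : (N ^ 2 + r ^ 2 + 1 + (1 + δ) / 2) * n < δ / 2 * n * n :=
    mul_lt_mul_of_pos_right h3 (by linarith)
  have : (extremalNumber n (completeEquipartiteGraph (r + 1) t) : ℝ) < G.edgeSet.ncard := by
    nlinarith
  exact_mod_cast this

/-! ### Blow-ups and the upper bound -/

theorem notMem_goodEdges_of_copy {U K W : Type*} {H : SimpleGraph W} {C : TopEdgeLabeling U K}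
    (i : K) {φ : W → U} (hφ : Function.Injective φ)
    (hcol : ∀ a b, H.Adj a b → ∀ h : φ a ≠ φ b, C.get (φ a) (φ b) h = i)
    {a b : W} (hab : H.Adj a b) : s(φ a, φ b) ∉ goodEdges H C := by
  intro hgood
  refine hgood.2.2 ⟨i, ⟨⟨φ, fun {x y} hxy => ?_⟩, hφ⟩, ?_⟩
  · exact (TopEdgeLabeling.labelGraph_adj _ _).2
      ⟨hφ.ne hxy.ne, hcol x y hxy (hφ.ne hxy.ne)⟩
  · rw [Subgraph.mem_edgeSet, Copy.toSubgraph, Subgraph.map_adj]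
    exact ⟨a, b, hab, rfl, rfl⟩

/-- A family `w i x` of vertices such that the edges between distinct parts are coloured by `D`, and the
edges inside the parts are coloured by `v`. -/
structure IsBlowup {U K R S : Type*} (C : TopEdgeLabeling U K) (D : TopEdgeLabeling R K)
    (v : R → K) (w : R → S → U) : Prop where
  injective : ∀ i j x y, w i x = w j y → i = j ∧ x = y
  get_between : ∀ i j (h : i ≠ j) x y (h' : w i x ≠ w j y), C.get (w i x) (w j y) h' = D.get i j h
  get_inside : ∀ i x y (h' : w i x ≠ w i y), C.get (w i x) (w i y) h' = v i

/-- Ramsey is applied to positions in `Fin T`, a pair `a < b` being coloured by the whole `R × R`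
matrix of colours between the vertices at `a` and those at `b`. -/
theorem exists_isBlowup (K : Type*) [Finite K] [Nonempty K] (R s : ℕ) :
    ∃ T : ℕ, T ≠ 0 ∧ ∀ (U : Type) (C : TopEdgeLabeling U K) (f : Fin R × Fin T → U),
      Function.Injective f → ∃ (D : TopEdgeLabeling (Fin R) K) (v : Fin R → K)
        (p : Fin R → Fin s → Fin T), IsBlowup C D v (fun i x => f (i, p i x)) := by
  classical
  obtain ⟨T, hT⟩ := exists_ramsey (Fin R → Fin R → K) (R * s + 1)
  have hT0 : T ≠ 0 := by
    rintro rfl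
    obtain ⟨d⟩ := ‹Nonempty K›
    obtain ⟨e, -⟩ := hT (fun _ _ _ _ => d)
    exact (e 0).elim0
  refine ⟨T, hT0, fun U C f hf => ?_⟩
  obtain ⟨d⟩ := ‹Nonempty K›
  let col : U → U → K := fun x y => if h : x ≠ y then C.get x y h else d
  have hcol : ∀ x y (h : x ≠ y), C.get x y h = col x y := fun x y h => by simp [col, h]
  have hsymm : ∀ x y, col x y = col y x := fun x y => by
    by_cases h : x = y
    · rw [h]
    · rw [← hcol x y h, ← hcol y x (Ne.symm h)]; exact EdgeLabeling.get_comm _ _ _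
  obtain ⟨e, he⟩ := hT (fun a b i j => col (f (i, a)) (f (j, b)))
  obtain ⟨c, hc⟩ : ∃ c : Fin R → Fin R → K, ∀ a b, a < b → ∀ i j,
      col (f (i, e a)) (f (j, e b)) = c i j := by
    by_cases hex : ∃ a b : Fin (R * s + 1), a < b
    · obtain ⟨a₀, b₀, h₀⟩ := hex
      exact ⟨_, fun a b hab i j => congrFun (congrFun (he a b a₀ b₀ hab h₀) i) j⟩
    · exact ⟨fun _ _ => d, fun a b hab => absurd ⟨a, b, hab⟩ hex⟩
  -- Part `i` takes the `i`-th block of `s` positions. For `i < j` its positions precede those of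
  -- part `j`, so only `c i j`, never `c j i`, occurs between them. The spare last position only
  -- serves to force `T ≠ 0`.
  let q : Fin R → Fin s → Fin (R * s + 1) := fun i x => (finProdFinEquiv (i, x)).castSucc
  have hq : ∀ i x, ((q i x : Fin _) : ℕ) = x + s * i := fun i x => rfl
  have hq1 : ∀ i j x y, i < j → q i x < q j y := fun i j x y hij => by
    rw [Fin.lt_def, hq, hq]
    have h1 := x.2
    have h2 : s * (i + 1 : ℕ) ≤ s * j := Nat.mul_le_mul_left _ hij
    rw [Nat.mul_add] at h2
    omega
  have hq2 : ∀ i x y, x < y → q i x < q i y := fun i x y hxy => by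
    rw [Fin.lt_def, hq, hq]; exact Nat.add_lt_add_right hxy _
  refine ⟨EdgeLabeling.mk (fun i j _ => if i < j then c i j else c j i) ?_, fun i => c i i,
    fun i x => e (q i x), ⟨?_, ?_, ?_⟩⟩
  · intro i j hij
    rcases lt_or_gt_of_ne (show i ≠ j from hij) with h | h <;> simp [h, h.not_gt]
  · intro i j x y h
    have h1 := hf h
    obtain ⟨rfl, h2⟩ := Prod.mk.inj h1
    refine ⟨rfl, ?_⟩
    have h3 := e.injective h2
    rcases lt_trichotomy x y with h | h | h
    · exact absurd h3 (hq2 i x y h).ne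
    · exact h
    · exact absurd h3 (hq2 i y x h).ne'
  · intro i j h x y h'
    rw [hcol, EdgeLabeling.get_mk]
    rcases lt_or_gt_of_ne h with h | h
    · rw [if_pos h, hc _ _ (hq1 i j x y h)]
    · rw [if_neg h.not_gt, hsymm, hc _ _ (hq1 j i y x h)]
  · intro i x y h'
    rw [hcol]
    rcases lt_trichotomy x y with h | h | h
    · exact hc _ _ (hq2 i x y h) i i
    · exact absurd (by rw [h]) h'
    · rw [hsymm]; exact hc _ _ (hq2 i y x h) i i

/-- There is no blowup of a colouring of order `GR*_k(H)` all of whose edges between distinct parts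
are good. -/
theorem not_isBlowup_of_goodEdges {W U : Type*} [Finite W] {H : SimpleGraph W} (hH : H ≠ ⊥)
    {k R : ℕ}
    (hR : ∀ (v : Fin R → Fin k) (C : TopEdgeLabeling (Fin R) (Fin k)),
      (∃ x y z, IsRainbowTriangle C x y z) ∨ (∃ G ∈ homCopies H, HasMonoCopy G.2 C) ∨
      (∃ (i j : Fin R) (hij : i ≠ j), C.get i j hij = v i ∨ C.get i j hij = v j))
    {C : TopEdgeLabeling U (Fin k)} {D : TopEdgeLabeling (Fin R) (Fin k)} {v : Fin R → Fin k}
    {w : Fin R → W → U} (hw : IsBlowup C D v w)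
    (hgood : ∀ i j x y, i ≠ j → s(w i x, w j y) ∈ goodEdges H C) : False := by
  classical
  obtain ⟨a, b, hab⟩ := ne_bot_iff_exists_adj.1 hH
  have hne : ∀ i j x y, i ≠ j → w i x ≠ w j y := fun i j x y hij h =>
    hij (hw.injective _ _ _ _ h).1
  have hend : ∀ i j (hij : i ≠ j), D.get i j hij ≠ v i := by
    intro i j hij hD
    -- Only `a` is moved to part `j`: its edges get colour `D i j = v i`, as do the edges inside
    -- part `i`, and `ab` becomes a good cross edge.
    let φ : W → U := fun z => if z = a then w j z else w i z
    have hφ : Function.Injective φ := fun x y hxy => by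
      simp only [φ] at hxy
      split_ifs at hxy <;> exact (hw.injective _ _ _ _ hxy).2
    refine notMem_goodEdges_of_copy (C := C) (v i) hφ (fun x y hxy h => ?_) hab ?_
    · simp only [φ] at h ⊢
      by_cases hx : x = a
      · have hy : y ≠ a := fun hy => hxy.ne (hx.trans hy.symm)
        simp only [if_pos hx, if_neg hy]
        rw [hw.get_between j i hij.symm, EdgeLabeling.get_comm]; exact hD
      · by_cases hy : y = a
        · simp only [if_neg hx, if_pos hy]
          rw [hw.get_between i j hij]; exact hD
        · simp only [if_neg hx, if_neg hy]
          exact hw.get_inside i x y _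
    · simp only [φ, if_true, if_neg hab.ne']
      exact hgood j i a b hij.symm
  rcases hR v D with ⟨x, y, z, hxy, hyz, hxz, h1, h2, h3⟩ | ⟨G, ⟨ψ⟩, c, ⟨κ⟩⟩ | ⟨i, j, hij, h | h⟩
  · refine (hgood x y a a hxy).2.1 ⟨w x a, w y a, w z a,
      ⟨hne _ _ _ _ hxy, hne _ _ _ _ hyz, hne _ _ _ _ hxz, ?_⟩, Or.inl rfl⟩
    rw [hw.get_between _ _ hxy, hw.get_between _ _ hyz, hw.get_between _ _ hxz]
    exact ⟨h1, h2, h3⟩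
  · let θ : H →g D.labelGraph c := κ.toHom.comp ψ
    have hθ : ∀ x y, H.Adj x y → ∃ h : θ x ≠ θ y, D.get (θ x) (θ y) h = c := fun x y hxy =>
      (TopEdgeLabeling.labelGraph_adj _ _).1 (θ.map_adj hxy)
    -- Using `x` itself as the index within part `θ x` makes the homomorphism injective.
    refine notMem_goodEdges_of_copy (C := C) (φ := fun x => w (θ x) x) c
      (fun x y hxy => (hw.injective _ _ _ _ hxy).2) (fun x y hxy h => ?_) hab
      (hgood _ _ _ _ (hθ a b hab).1)
    obtain ⟨h1, h2⟩ := hθ x y hxy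
    rw [hw.get_between _ _ h1, h2]
  · exact hend i j hij h
  · exact hend j i hij.symm (by rw [EdgeLabeling.get_comm]; exact h)

theorem exists_ncard_goodEdges_eq {W : Type*} (k n : ℕ) (hk : 0 < k) (H : SimpleGraph W) :
    ∃ C : TopEdgeLabeling (Fin n) (Fin k), (goodEdges H C).ncard = maxGoodEdges k n H :=
  have : Nonempty (Fin k) := ⟨⟨0, hk⟩⟩
  exists_eq_ciSup_of_finite

theorem edgeSet_fromEdgeSet_goodEdges {U K W : Type*} (H : SimpleGraph W)
    (C : TopEdgeLabeling U K) : (fromEdgeSet (goodEdges H C)).edgeSet = goodEdges H C := by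
  rw [edgeSet_fromEdgeSet, sdiff_eq_left, Set.disjoint_left]
  exact fun e he h => (not_isDiag_of_mem_edgeSet _ he.1) h

/-- The upper bound for `f_k(n, H)`. -/
theorem exists_maxGoodEdges_lt {W : Type*} [Finite W] {H : SimpleGraph W} (hH : H ≠ ⊥)
    {k : ℕ} (hk : 0 < k) {δ : ℝ} (hδ : 0 < δ) :
    ∃ n₀ : ℕ, ∀ n : ℕ, n₀ ≤ n → (maxGoodEdges k n H : ℝ) <
      (turanEdges n (gallaiRamseyStar k H - 1) : ℝ) + δ * (n : ℝ) ^ 2 := by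
  classical
  have hKne : Nonempty (Fin k) := ⟨⟨0, hk⟩⟩
  -- If `r = 0`, `turanGraph n 0` is complete and the bound is trivial. Otherwise the infimum is
  -- positive, hence attained.
  obtain hr | hr := Nat.eq_zero_or_pos (gallaiRamseyStar k H - 1)
  · refine ⟨1, fun n hn => ?_⟩
    rw [hr]
    obtain ⟨C, hC⟩ := exists_ncard_goodEdges_eq k n hk H
    have h1 : maxGoodEdges k n H ≤ turanEdges n 0 := by
      rw [← hC, turanEdges, ← Set.ncard_coe_finset, coe_edgeFinset, turanGraph_zero]
      exact Set.ncard_le_ncard (fun e he => he.1) (Set.toFinite _)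
    have h2 : (maxGoodEdges k n H : ℝ) ≤ turanEdges n 0 := by exact_mod_cast h1
    have h3 : (0 : ℝ) < n := by exact_mod_cast hn
    have : 0 < δ * (n : ℝ) ^ 2 := by positivity
    linarith
  · have hpos : gallaiRamseyStar k H ≠ 0 := by omega
    have hmem := Nat.sInf_mem (Nat.nonempty_of_pos_sInf (Nat.pos_of_ne_zero hpos))
    change gallaiRamseyStar k H ∈ _ at hmem
    obtain ⟨r, hr'⟩ : ∃ r, gallaiRamseyStar k H = r + 1 := ⟨_, (Nat.succ_pred hpos).symm⟩
    rw [hr'] at hmem hr ⊢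
    rw [Nat.add_sub_cancel] at hr ⊢
    obtain ⟨T, hT0, hT⟩ := exists_isBlowup (Fin k) (r + 1) (Nat.card W)
    obtain ⟨N, hN⟩ := exists_completeEquipartiteGraph_isContained hδ hr hT0
    refine ⟨N, fun n hn => ?_⟩
    by_contra! hle
    obtain ⟨C, hC⟩ := exists_ncard_goodEdges_eq k n hk H
    obtain ⟨f⟩ := hN n hn (fromEdgeSet (goodEdges H C)) (by
      rw [edgeSet_fromEdgeSet_goodEdges, hC]; exact hle)
    obtain ⟨D, v, p, hw⟩ := hT (Fin n) C f f.injective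
    let eW := Finite.equivFin W
    refine not_isBlowup_of_goodEdges hH hmem (C := C) (D := D) (v := v)
      (w := fun i x => f (i, p i (eW x))) ⟨fun i j x y h => ?_, fun i j h x y h' => ?_,
        fun i x y h' => ?_⟩ fun i j x y hij => ?_
    · have := hw.injective i j (eW x) (eW y) h
      exact ⟨this.1, eW.injective this.2⟩
    · exact hw.get_between i j h (eW x) (eW y) h'
    · exact hw.get_inside i (eW x) (eW y) h'
    · have := f.toHom.map_adj (v := (i, p i (eW x))) (w := (j, p j (eW y)))
        (completeEquipartiteGraph_adj.2 hij)
      exact ((fromEdgeSet_adj _).1 this).1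

/-! ### The lower bound -/

/-- A one-part blow-up is a monochromatic clique on `|W|` vertices, which is a homomorphic copy of
`H`. -/
theorem gallaiRamsey_homCopies_mem {W : Type*} [Finite W] (k : ℕ) (hk : 0 < k)
    (H : SimpleGraph W) :
    gallaiRamsey k (homCopies H) ∈ {n : ℕ | ∀ C : TopEdgeLabeling (Fin n) (Fin k),
      IsGallai C → ∃ G ∈ homCopies H, HasMonoCopy G.2 C} := by
  classical
  refine Nat.sInf_mem ?_
  have : Nonempty (Fin k) := ⟨⟨0, hk⟩⟩
  obtain ⟨T, -, hT⟩ := exists_isBlowup (Fin k) 1 (Nat.card W)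
  refine ⟨T, fun C _ => ?_⟩
  obtain ⟨D, v, p, hw⟩ := hT (Fin T) C Prod.snd (fun x y h => Prod.ext (Subsingleton.elim _ _) h)
  refine ⟨⟨Nat.card W, ⊤⟩, ⟨⟨Finite.equivFin W, fun h => (Finite.equivFin W).injective.ne h.ne⟩⟩,
    v 0, ⟨⟨⟨p 0, fun {x y} h => ?_⟩, fun x y h => (hw.injective 0 0 x y h).2⟩⟩⟩
  have hne : p 0 x ≠ p 0 y := fun h' => h ((hw.injective 0 0 x y h').2)
  exact (TopEdgeLabeling.labelGraph_adj _ _).2 ⟨hne, hw.get_inside 0 x y hne⟩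

theorem one_lt_gallaiRamsey {W : Type*} [Finite W] {k : ℕ} (hk : 0 < k) {H : SimpleGraph W}
    (hH : H ≠ ⊥) : 1 < gallaiRamsey k (homCopies H) := by
  obtain ⟨a, b, hab⟩ := ne_bot_iff_exists_adj.1 hH
  obtain ⟨G, ⟨ψ⟩, c, ⟨κ⟩⟩ := gallaiRamsey_homCopies_mem k hk H (fun _ => ⟨0, hk⟩)
    (fun x y z ⟨_, _, _, h, _⟩ => h rfl)
  have h := (κ.toHom.map_adj (ψ.map_adj hab)).ne
  have := Fin.val_ne_of_ne h
  have h1 := (κ.toHom (ψ a)).2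
  have h2 := (κ.toHom (ψ b)).2
  omega

/-- The lower bound for `f_k(n, H)`. -/
theorem turanEdges_le_maxGoodEdges {W : Type*} [Finite W] {H : SimpleGraph W} (hH : H ≠ ⊥)
    {k : ℕ} (hk : 0 < k) (n : ℕ) :
    turanEdges n (gallaiRamsey k (homCopies H) - 1) ≤ maxGoodEdges (k + 1) n H := by
  classical
  have h1 := one_lt_gallaiRamsey hk hH
  set r := gallaiRamsey k (homCopies H) - 1 with hr
  have hr0 : 0 < r := by omega
  have hnot : r ∉ {n : ℕ | ∀ C : TopEdgeLabeling (Fin n) (Fin k),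
      IsGallai C → ∃ G ∈ homCopies H, HasMonoCopy G.2 C} :=
    Nat.notMem_of_lt_sInf (show r < gallaiRamsey k (homCopies H) by omega)
  simp only [Set.mem_ofPred_eq, not_forall] at hnot
  obtain ⟨C₀, hG, hno⟩ := hnot
  let p : Fin n → Fin r := fun x => ⟨x % r, Nat.mod_lt _ hr0⟩
  let C : TopEdgeLabeling (Fin n) (Fin (k + 1)) := EdgeLabeling.mk
    (fun x y _ => if h : p x ≠ p y then (C₀.get (p x) (p y) h).castSucc else Fin.last k)
    (fun x y _ => by
      by_cases h : p x = p y
      · rw [dif_neg (not_not.2 h.symm), dif_neg (not_not.2 h)]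
      · rw [dif_pos (Ne.symm h), dif_pos h, EdgeLabeling.get_comm])
  have hCne : ∀ x y h (h' : p x ≠ p y), C.get x y h = (C₀.get (p x) (p y) h').castSucc :=
    fun x y h h' => by rw [EdgeLabeling.get_mk, dif_pos h']
  have hCeq : ∀ x y h, p x = p y → C.get x y h = Fin.last k :=
    fun x y h h' => by rw [EdgeLabeling.get_mk, dif_neg (not_not.2 h')]
  have hCcol : ∀ x y h c, C.get x y h = Fin.castSucc c → ∃ h' : p x ≠ p y,
      C₀.get (p x) (p y) h' = c := fun x y h c hc => by
    by_cases h' : p x = p y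
    · rw [hCeq x y h h'] at hc
      exact absurd hc.symm (Fin.castSucc_lt_last c).ne
    · rw [hCne x y h h'] at hc
      exact ⟨h', Fin.castSucc_injective _ hc⟩
  -- Colours depend only on classes, so a rainbow triangle must meet three classes and projects to
  -- one in `C₀`.
  have hCcongr : ∀ a b c d (h : a ≠ b) (h' : c ≠ d), p a = p c → p b = p d →
      C.get a b h = C.get c d h' := fun a b c d h h' hac hbd => by
    by_cases hab : p a = p b
    · rw [hCeq a b h hab, hCeq c d h' (by rw [← hac, hab, hbd])]
    · have hcd : p c ≠ p d := by rwa [← hac, ← hbd]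
      rw [hCne a b h hab, hCne c d h' hcd]
      congr 1
      simp only [hac, hbd]
  have hGallai : ∀ x y z, ¬ IsRainbowTriangle C x y z := by
    rintro x y z ⟨hxy, hyz, hxz, n1, n2, n3⟩
    by_cases exy : p x = p y
    · exact n3 (hCcongr y z x z hyz hxz exy.symm rfl)
    by_cases eyz : p y = p z
    · exact n2 (hCcongr x y x z hxy hxz rfl eyz)
    by_cases exz : p x = p z
    · refine n1 ?_
      rw [EdgeLabeling.get_comm (C := C) y x hxy]
      exact hCcongr y x y z hxy.symm hyz rfl exz
    rw [hCne x y hxy exy, hCne y z hyz eyz] at n1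
    rw [hCne x y hxy exy, hCne x z hxz exz] at n2
    rw [hCne y z hyz eyz, hCne x z hxz exz] at n3
    exact hG (p x) (p y) (p z) ⟨exy, eyz, exz, fun h => n1 (congrArg _ h),
      fun h => n2 (congrArg _ h), fun h => n3 (congrArg _ h)⟩
  have hsub : (turanGraph n r).edgeSet ⊆ goodEdges H C := by
    intro e he
    induction e using Sym2.ind with
    | _ x y =>
    have hxy : p x ≠ p y := fun h => he (Fin.mk.inj_iff.1 h)
    refine ⟨fun h => hxy (congrArg p h), fun ⟨x, y, z, h, _⟩ => hGallai x y z h, ?_⟩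
    rintro ⟨i, φ, hφ⟩
    have hadj := φ.toSubgraph.adj_sub hφ
    obtain ⟨hne, hi⟩ := (TopEdgeLabeling.labelGraph_adj _ _).1 hadj
    rw [hCne x y hne hxy] at hi
    subst hi
    -- A copy of `H` through a cross edge has an old colour, so all its edges are cross edges and
    -- `p` maps it homomorphically into one colour class of `C₀`.
    refine hno ⟨⟨r, C₀.labelGraph (C₀.get (p x) (p y) hxy)⟩,
      ⟨⟨fun a => p (φ a), fun {a b} hab => ?_⟩⟩, _, IsContained.refl _⟩
    obtain ⟨h2, h3⟩ := (TopEdgeLabeling.labelGraph_adj _ _).1 (φ.toHom.map_adj hab)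
    exact (TopEdgeLabeling.labelGraph_adj _ _).2 (hCcol _ _ h2 _ h3)
  calc turanEdges n r = (turanGraph n r).edgeSet.ncard := by
        rw [turanEdges, ← Set.ncard_coe_finset, coe_edgeFinset]
    _ ≤ (goodEdges H C).ncard := Set.ncard_le_ncard hsub (Set.toFinite _)
    _ ≤ maxGoodEdges (k + 1) n H :=
        le_ciSup (f := fun C : TopEdgeLabeling (Fin n) (Fin (k + 1)) => (goodEdges H C).ncard)
          (Set.finite_range _).bddAbove C

end GallaiEdges

theorem mainTheorem6 (k : ℕ) (hk : 2 ≤ k) {V : Type*} [Finite V] (H : SimpleGraph V) (hH : H ≠ ⊥)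
    (δ : ℝ) (hδ : 0 < δ) :
    ∃ n₀ : ℕ, ∀ n : ℕ, n₀ ≤ n →
      GallaiEdges.turanEdges n
          (GallaiEdges.gallaiRamsey (k - 1) (GallaiEdges.homCopies H) - 1) ≤
        GallaiEdges.maxGoodEdges k n H ∧
      (GallaiEdges.maxGoodEdges k n H : ℝ) <
        (GallaiEdges.turanEdges n (GallaiEdges.gallaiRamseyStar k H - 1) : ℝ) +
          δ * (n : ℝ) ^ 2 := by
  obtain ⟨n₀, h⟩ := GallaiEdges.exists_maxGoodEdges_lt hH (k := k) (by omega) hδ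
  refine ⟨n₀, fun n hn => ⟨?_, h n hn⟩⟩
  have := GallaiEdges.turanEdges_le_maxGoodEdges hH (k := k - 1) (by omega) n
  rwa [Nat.sub_add_cancel (by omega)] at this
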